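/- A (two-party, multi-round) quantum communication protocol without prior entanglement works as follows. Alice receives $x\in X$, Bob receives $y\in Y$ (for example $X=Y=\{0,1\}^n$). They start in a product state $\rho_{A_0}\otimes\sigma_{B_0}$ of finite-dimensional local registers. Alice applies an isometry $A_0\to A_1M_1$ depending on $x$ and sends the message $M_1$ to Bob, keeping $A_1$; Bob applies an isometry $M_1B_0\to M_2B_1$ depending on $y$ and sends $M_2$ to Alice, keeping $B_1$; and so on in alternation. When the last message $M_{2r-1}$ ($r\ge 1$) has arrived at Bob, he measures it together with his memory $B_{r-1}$ by a two-outcome measurement depending on $y$, and outputs the outcome. Each message $M_k$ consists of a number $q_k\ge 0$ of qubits that does not depend on the inputs, and the protocol is a $Q$-qubit protocol if $\sum_{k=1}^{2r-1}q_k=Q$. (An isometry is a unitary acting on the register together with freshly prepared ancillas.) The protocol is memoryless if all the registers $A_i$ and $B_i$ are one-dimensional, that is, if neither party keeps any quantum memory while a message is on its way. Proposition (memoryless protocol). For every $Q$-qubit quantum communication protocol without prior entanglement there is a memoryless quantum communication protocol which communicates $Q^2+2Q$ qubits in total and which, for all inputs $x,y$, produces each output $z\in\{0,1\}$ with exactly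 the same probability as the original protocol. -/

import Mathlib

open scoped Matrix Kronecker ComplexOrder

namespace QComm

/-- Computational basis labels of a register of `q` qubits; the register has dimension `2 ^ q`. -/
abbrev Qubits (q : ℕ) : Type := Fin q → Fin 2

/-- A density matrix (mixed quantum state) of a register with basis labels `n`. -/
structure DensityMatrix (n : Type) [Fintype n] where
  mat : Matrix n n ℂ
  posSemidef : mat.PosSemidef
  trace_eq_one : mat.trace = 1

/-- A linear isometry from a register with basis labels `n` to a register with basis labels `m`.
When the two dimensions agree it is a unitary; in general it is a unitary applied to the register
together with freshly prepared ancillas. -/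
structure LocalIsometry (m n : Type) [Fintype m] [Fintype n] [DecidableEq n] where
  mat : Matrix m n ℂ
  isometry : matᴴ * mat = 1

/-- A two-outcome quantum measurement (POVM) on a register with basis labels `n`. -/
structure Measurement (n : Type) [Fintype n] [DecidableEq n] where
  effect : Bool → Matrix n n ℂ
  posSemidef : ∀ z, (effect z).PosSemidef
  sum_eq_one : effect false + effect true = 1

/-- Basis labels of the joint system: Alice's memory (dimension `a`), the message register
(`q` qubits), Bob's memory (dimension `b`). -/
abbrev Joint (a q b : ℕ) : Type := Fin a × Qubits q × Fin b

/-- An operation of Alice on her memory and the message, extended by the identity on Bob's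
memory. -/
def onAlice {a q a' q' : ℕ} (b : ℕ)
    (U : Matrix (Fin a' × Qubits q') (Fin a × Qubits q) ℂ) :
    Matrix (Joint a' q' b) (Joint a q b) ℂ :=
  (U ⊗ₖ (1 : Matrix (Fin b) (Fin b) ℂ)).submatrix
    (Equiv.prodAssoc (Fin a') (Qubits q') (Fin b)).symm
    (Equiv.prodAssoc (Fin a) (Qubits q) (Fin b)).symm

/-- An operation of Bob on the message and his memory, extended by the identity on Alice's
memory. -/
def onBob {q b q' b' : ℕ} (a : ℕ)
    (V : Matrix (Qubits q' × Fin b') (Qubits q × Fin b) ℂ) :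
    Matrix (Joint a q' b') (Joint a q b) ℂ :=
  (1 : Matrix (Fin a) (Fin a) ℂ) ⊗ₖ V

/-- What is left of a protocol at a moment when a message of `q` qubits has just arrived at Bob,
while Alice keeps a memory of dimension `a` and Bob keeps a memory of dimension `b`.
Inputs come from `X` (Alice) and `Y` (Bob).
* `measure`: Bob measures the message and his memory, and outputs the outcome.
* `round`: Bob applies an isometry depending on `y` and sends `q'` qubits to Alice, keeping a memory
  of dimension `b'`; then Alice applies an isometry depending on `x` and sends `q''` qubits to Bob,
  keeping a memory of dimension `a'`; then the protocol goes on with `rest`. -/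
inductive Continuation (X : Type*) (Y : Type*) : (a q b : ℕ) → Type _ where
  | measure {a q b : ℕ} (E : Y → Measurement (Qubits q × Fin b)) : Continuation X Y a q b
  | round {a q b q' b' a' q'' : ℕ}
      (V : Y → LocalIsometry (Qubits q' × Fin b') (Qubits q × Fin b))
      (U : X → LocalIsometry (Fin a' × Qubits q'') (Fin a × Qubits q'))
      (rest : Continuation X Y a' q'' b') : Continuation X Y a q b

namespace Continuation

variable {X : Type*} {Y : Type*}

/-- The number of qubits that are still to be communicated, in both directions together. -/
def cost {a q b : ℕ} : Continuation X Y a q b → ℕ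
  | measure _ => 0
  | round (q' := q') (q'' := q'') _ _ rest => q' + q'' + rest.cost

/-- From now on all memories that are kept while a message is on its way are trivial
(one-dimensional). -/
def Memoryless {a q b : ℕ} : Continuation X Y a q b → Prop
  | measure _ => True
  | round (b' := b') (a' := a') _ _ rest => b' = 1 ∧ a' = 1 ∧ rest.Memoryless

/-- The probability of the output `z` on the inputs `x`, `y` when the current joint state is `ρ`. -/
noncomputable def outputProb {a q b : ℕ} (x : X) (y : Y) (z : Bool) :
    Continuation X Y a q b → Matrix (Joint a q b) (Joint a q b) ℂ → ℝ
  | measure E, ρ => (onBob a ((E y).effect z) * ρ).trace.re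
  | round (b' := b') V U rest, ρ =>
      rest.outputProb x y z
        ((onAlice b' (U x).mat * onBob a (V y).mat) * ρ *
          (onAlice b' (U x).mat * onBob a (V y).mat)ᴴ)

end Continuation

/-- A multi-round two-party quantum communication protocol without prior entanglement, with inputs
from `X` and `Y` and an output bit. Alice and Bob start in a product state `ρA ⊗ ρB`, of local
dimensions `a₀` and `b₀`. Alice applies an isometry depending on `x`, sends `q₁` qubits to Bob and
keeps a memory of dimension `a₁`; then the parties proceed as in `rest`. Messages alternate, the
first one goes from Alice to Bob, and after the last one Bob measures. -/
structure Protocol (X : Type*) (Y : Type*) where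
  a₀ : ℕ
  b₀ : ℕ
  ρA : DensityMatrix (Fin a₀)
  ρB : DensityMatrix (Fin b₀)
  q₁ : ℕ
  a₁ : ℕ
  U₁ : X → LocalIsometry (Fin a₁ × Qubits q₁) (Fin a₀)
  rest : Continuation X Y a₁ q₁ b₀

namespace Protocol

variable {X : Type*} {Y : Type*}

/-- The total number of qubits communicated. -/
def cost (P : Protocol X Y) : ℕ := P.q₁ + P.rest.cost

/-- No party has any quantum memory besides the message: all memory registers, the initial ones
included, are one-dimensional. -/
def Memoryless (P : Protocol X Y) : Prop :=
  P.a₀ = 1 ∧ P.b₀ = 1 ∧ P.a₁ = 1 ∧ P.rest.Memoryless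

/-- The joint state after Alice's first operation on input `x`. -/
noncomputable def firstState (P : Protocol X Y) (x : X) :
    Matrix (Joint P.a₁ P.q₁ P.b₀) (Joint P.a₁ P.q₁ P.b₀) ℂ :=
  (((P.U₁ x).mat * P.ρA.mat * (P.U₁ x).matᴴ) ⊗ₖ P.ρB.mat).submatrix
    (Equiv.prodAssoc (Fin P.a₁) (Qubits P.q₁) (Fin P.b₀)).symm
    (Equiv.prodAssoc (Fin P.a₁) (Qubits P.q₁) (Fin P.b₀)).symm

/-- The probability that the protocol outputs the bit `z` on the inputs `x`, `y`. -/
noncomputable def outputProb (P : Protocol X Y) (x : X) (y : Y) (z : Bool) : ℝ :=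
  P.rest.outputProb x y z (P.firstState x)

end Protocol

end QComm

/-!
At every moment the joint state arises, by local operations of Alice and of Bob, from a state of two
registers of `s` qubits each, where `s` is the number of qubits sent so far: a message of `q` qubits
raises the Schmidt rank by a factor of at most `2 ^ q`. A party can therefore hand over to the other
one not only the message but the whole compressed joint state, in `2 * s` qubits, and needs no
memory. Empty messages are absorbed into the local operations, so that at most `Q` messages remain.
Summing their sizes gives at most `Q ^ 2 + Q` qubits; unused qubits pad the last message.

The argument runs in the Heisenberg picture, backwards from the final measurement: what is
transported are the effects on the joint register, and the local operations are Kraus families.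
-/

namespace QComm

open Matrix

section IsometricMatrices

variable {𝕜 k l m n : Type*} [RCLike 𝕜] [Fintype m]

theorem conjTranspose_mul_self_eq_one_iff_orthonormal [DecidableEq n] (J : Matrix m n 𝕜) :
    Jᴴ * J = 1 ↔ Orthonormal 𝕜 fun j => WithLp.toLp 2 (J.col j) := by
  rw [orthonormal_iff_ite, ← Matrix.ext_iff]
  refine forall₂_congr fun i j => ?_
  rw [one_apply, EuclideanSpace.inner_toLp_toLp, dotProduct_comm]
  rfl

theorem isometry_submatrix_embedding [DecidableEq n] [DecidableEq k] {B : Matrix m n 𝕜}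
    (hB : Bᴴ * B = 1) (κ : k ↪ n) : (B.submatrix id κ)ᴴ * B.submatrix id κ = 1 := by
  rw [conjTranspose_mul_self_eq_one_iff_orthonormal] at hB ⊢
  exact hB.comp κ κ.injective

theorem card_le_of_isometry [Fintype n] [DecidableEq n] {J : Matrix m n 𝕜} (hJ : Jᴴ * J = 1) :
    Fintype.card n ≤ Fintype.card m := by
  have h := rank_mul_le_right Jᴴ J
  rw [hJ, rank_one] at h
  exact h.trans (rank_le_card_height J)

theorem exists_unitary_submatrix_eq [DecidableEq m] [DecidableEq n] {J : Matrix m n 𝕜}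
    (hJ : Jᴴ * J = 1) (ι : n ↪ m) : ∃ B : Matrix m m 𝕜, Bᴴ * B = 1 ∧ B.submatrix id ι = J := by
  let w : n → EuclideanSpace 𝕜 m := fun j => WithLp.toLp 2 (J.col j)
  let v : m → EuclideanSpace 𝕜 m := Function.extend ι w 0
  have hv : ∀ j, v (ι j) = w j := ι.injective.extend_apply w 0
  have hvo : Orthonormal 𝕜 ((Set.range ι).domRestrict v) := by
    have hw : Orthonormal 𝕜 w := (conjTranspose_mul_self_eq_one_iff_orthonormal J).1 hJ
    convert hw.comp _ (Equiv.ofInjective ι ι.injective).symm.injective using 1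
    ext1 ⟨_, j, rfl⟩
    simp [hv]
  obtain ⟨b, hb⟩ := hvo.exists_orthonormalBasis_extension_of_card_eq (by simp)
  refine ⟨.of fun i j => b j i, ?_, ?_⟩
  · exact (conjTranspose_mul_self_eq_one_iff_orthonormal _).2 b.orthonormal
  · ext i j
    simp [hb (ι j) ⟨j, rfl⟩, hv, w]

theorem exists_isometry_mul_eq [Fintype n] [DecidableEq n] [Finite k] [DecidableEq k]
    {J : Matrix n k 𝕜} (hJ : Jᴴ * J = 1) {U : Matrix m k 𝕜} (hU : Uᴴ * U = 1)
    (h : Fintype.card n ≤ Fintype.card m) : ∃ A : Matrix m n 𝕜, Aᴴ * A = 1 ∧ A * J = U := by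
  classical
  have := Fintype.ofFinite k
  obtain ⟨ι⟩ := Function.Embedding.nonempty_of_card_le (card_le_of_isometry hJ)
  obtain ⟨κ⟩ := Function.Embedding.nonempty_of_card_le h
  obtain ⟨B, hB, rfl⟩ := exists_unitary_submatrix_eq hJ ι
  obtain ⟨C, hC, rfl⟩ := exists_unitary_submatrix_eq hU (ι.trans κ)
  have hB' : B * Bᴴ = 1 := mul_eq_one_comm.1 hB
  have hC' := isometry_submatrix_embedding hC κ
  refine ⟨C.submatrix id κ * Bᴴ, ?_, ?_⟩
  · rw [conjTranspose_mul, conjTranspose_conjTranspose, Matrix.mul_assoc,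
      ← Matrix.mul_assoc _ _ Bᴴ, hC', Matrix.one_mul, hB']
  · calc C.submatrix id κ * Bᴴ * B.submatrix id ι
        = C.submatrix id κ * (Bᴴ * B).submatrix id ι := by
          rw [Matrix.mul_assoc]
          rfl
      _ = C.submatrix id (ι.trans κ) := by
          rw [hB]
          ext i j
          simp [mul_apply, one_apply]

theorem exists_isometry_fin_rank [Fintype n] (M : Matrix m n 𝕜) :
    ∃ W : Matrix m (Fin M.rank) 𝕜, Wᴴ * W = 1 ∧ W * (Wᴴ * M) = M := by
  let S : Submodule 𝕜 (EuclideanSpace 𝕜 m) :=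
    (Submodule.span 𝕜 (Set.range M.col)).map (WithLp.linearEquiv 2 𝕜 (m → 𝕜)).symm.toLinearMap
  have hS : Module.finrank 𝕜 S = M.rank := by
    rw [rank_eq_finrank_span_cols]
    exact LinearEquiv.finrank_map_eq _ _
  let b := (stdOrthonormalBasis 𝕜 S).reindex (finCongr hS)
  refine ⟨.of fun i j => (b j : EuclideanSpace 𝕜 m) i, ?_, ?_⟩
  · exact (conjTranspose_mul_self_eq_one_iff_orthonormal _).2
      (b.orthonormal.comp_linearIsometry S.subtypeₗᵢ)
  · ext i j
    let c : S := ⟨WithLp.toLp 2 (M.col j), M.col j, Submodule.subset_span ⟨j, rfl⟩, rfl⟩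
    have h := congrArg (fun u : S => (u : EuclideanSpace 𝕜 m) i) (b.sum_repr' c)
    simp only [Submodule.coe_sum, Submodule.coe_smul, WithLp.ofLp_sum, Finset.sum_apply,
      WithLp.ofLp_smul, Pi.smul_apply, smul_eq_mul, Submodule.coe_inner] at h
    rw [mul_apply, show M i j = (c : EuclideanSpace 𝕜 m) i from rfl, ← h]
    refine Finset.sum_congr rfl fun k _ => ?_
    rw [mul_comm, EuclideanSpace.inner_eq_star_dotProduct, dotProduct_comm]
    rfl

theorem exists_isometry_of_rank_le [Fintype n] [Fintype l] [DecidableEq l] {M : Matrix m n 𝕜}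
    (hM : M.rank ≤ Fintype.card l) (hl : Fintype.card l ≤ Fintype.card m) :
    ∃ W : Matrix m l 𝕜, Wᴴ * W = 1 ∧ W * (Wᴴ * M) = M := by
  classical
  obtain ⟨W₀, hW₀, hM₀⟩ := exists_isometry_fin_rank M
  obtain ⟨ι⟩ := Function.Embedding.nonempty_of_card_le (α := Fin M.rank) (by simpa using hM)
  obtain ⟨κ⟩ := Function.Embedding.nonempty_of_card_le hl
  obtain ⟨B, hB, rfl⟩ := exists_unitary_submatrix_eq hW₀ (ι.trans κ)
  let W := B.submatrix id κ
  have hW : Wᴴ * W = 1 := isometry_submatrix_embedding hB κ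
  have hι : B.submatrix id (ι.trans κ) = W * (1 : Matrix l l 𝕜).submatrix id ι := by
    ext i j
    simp [W, mul_apply, one_apply]
  refine ⟨W, hW, ?_⟩
  rw [← hM₀, hι]
  simp only [← Matrix.mul_assoc]
  rw [Matrix.mul_assoc W Wᴴ W, hW, Matrix.mul_one]

end IsometricMatrices

section Pullback

variable {R : Type*} [CommRing R] [StarRing R] {k m n : Type*} [Fintype m]

/-- The Heisenberg picture of the operation `ρ ↦ A * ρ * Aᴴ`: an effect `E` after the operation
amounts to the effect `pullback A E` before it. -/
def pullback (A : Matrix m n R) (E : Matrix m m R) : Matrix n n R := Aᴴ * E * A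

theorem pullback_pullback [Fintype n] (A : Matrix m n R) (B : Matrix n k R) (E : Matrix m m R) :
    pullback B (pullback A E) = pullback (A * B) E := by
  simp only [pullback, conjTranspose_mul, Matrix.mul_assoc]

theorem pullback_sum {ι : Type*} (A : Matrix m n R) (s : Finset ι) (E : ι → Matrix m m R) :
    pullback A (∑ i ∈ s, E i) = ∑ i ∈ s, pullback A (E i) := by
  simp only [pullback, Matrix.mul_sum, Matrix.sum_mul]

theorem pullback_add (A : Matrix m n R) (E F : Matrix m m R) :
    pullback A (E + F) = pullback A E + pullback A F := by
  simp only [pullback, Matrix.mul_add, Matrix.add_mul]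

theorem trace_pullback_mul [Fintype n] (A : Matrix m n R) (E : Matrix m m R) (ρ : Matrix n n R) :
    (pullback A E * ρ).trace = (E * (A * ρ * Aᴴ)).trace := by
  rw [pullback, ← Matrix.mul_assoc E, trace_mul_comm _ Aᴴ]
  simp only [Matrix.mul_assoc]

theorem pullback_kronecker {m' n' : Type*} [Fintype m'] (A : Matrix m n R) (B : Matrix m' n' R)
    (E : Matrix m m R) (F : Matrix m' m' R) :
    pullback (A ⊗ₖ B) (E ⊗ₖ F) = pullback A E ⊗ₖ pullback B F := by
  simp only [pullback, conjTranspose_kronecker, mul_kronecker_mul]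

end Pullback

theorem sum_kronecker_sum {R ι κ l m n p : Type*} [CommSemiring R] (s : Finset ι) (t : Finset κ)
    (A : ι → Matrix l m R) (B : κ → Matrix n p R) :
    (∑ i ∈ s, A i) ⊗ₖ (∑ j ∈ t, B j) = ∑ i ∈ s, ∑ j ∈ t, A i ⊗ₖ B j := by
  ext
  simp [Matrix.sum_apply, Finset.sum_mul_sum]

namespace LocalIsometry

variable {k m n m' n' : Type} [Fintype k] [Fintype m] [Fintype n] [Fintype m'] [Fintype n']
  [DecidableEq k] [DecidableEq n] [DecidableEq n']

/-- The composition of two isometries. -/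
@[simps]
def comp (V : LocalIsometry m n) (W : LocalIsometry n k) : LocalIsometry m k where
  mat := V.mat * W.mat
  isometry := by
    rw [conjTranspose_mul, Matrix.mul_assoc, ← Matrix.mul_assoc _ V.mat, V.isometry,
      Matrix.one_mul, W.isometry]

/-- Two isometries acting side by side. -/
@[simps]
def tensor (V : LocalIsometry m n) (W : LocalIsometry m' n') :
    LocalIsometry (m × m') (n × n') where
  mat := V.mat ⊗ₖ W.mat
  isometry := by
    rw [conjTranspose_kronecker, ← mul_kronecker_mul, V.isometry, W.isometry, one_kronecker_one]

/-- Relabelling the bases of both registers. -/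
@[simps]
def reindex (e : m' ≃ m) (e' : n' ≃ n) (V : LocalIsometry m n) : LocalIsometry m' n' where
  mat := V.mat.submatrix e e'
  isometry := by
    rw [conjTranspose_submatrix, submatrix_mul_equiv, V.isometry, submatrix_one_equiv]

variable (n) in
/-- The operation that does nothing. -/
@[simps]
def id : LocalIsometry n n where
  mat := 1
  isometry := by rw [conjTranspose_one, Matrix.one_mul]

theorem exists_extension (J : LocalIsometry n k) (U : LocalIsometry m k)
    (h : Fintype.card n ≤ Fintype.card m) : ∃ A : LocalIsometry m n, A.mat * J.mat = U.mat := by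
  obtain ⟨A, hA, hAJ⟩ := exists_isometry_mul_eq J.isometry U.isometry h
  exact ⟨⟨A, hA⟩, hAJ⟩

theorem nonempty_of_card_le (h : Fintype.card n ≤ Fintype.card m) :
    Nonempty (LocalIsometry m n) := by
  classical
  obtain ⟨κ⟩ := Function.Embedding.nonempty_of_card_le h
  exact ⟨_, isometry_submatrix_embedding (id m).isometry κ⟩

end LocalIsometry

/-- A quantum channel from a register `n` to a register `m`, given by its Kraus operators. -/
structure KrausFamily (ε m n : Type) [Fintype ε] [Fintype m] [DecidableEq n] where
  op : ε → Matrix m n ℂ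
  sum_eq_one : ∑ e, (op e)ᴴ * op e = 1

namespace KrausFamily

variable {a b k m n m' n' r β ε ε' κ : Type} [Fintype b] [Fintype k] [Fintype m] [Fintype m']
  [Fintype r] [Fintype ε] [Fintype ε'] [Fintype κ] [DecidableEq n] [DecidableEq n']

/-- The Heisenberg picture of the channel, as in `QComm.pullback`. -/
def pullback (W : KrausFamily ε m n) (E : Matrix m m ℂ) : Matrix n n ℂ :=
  ∑ e, QComm.pullback (W.op e) E

/-- Two channels acting side by side. -/
@[simps]
def tensor (A : KrausFamily ε m n) (B : KrausFamily ε' m' n') :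
    KrausFamily (ε × ε') (m × m') (n × n') where
  op e := A.op e.1 ⊗ₖ B.op e.2
  sum_eq_one := by
    simp only [conjTranspose_kronecker, ← mul_kronecker_mul, Fintype.sum_prod_type]
    rw [← sum_kronecker_sum, A.sum_eq_one, B.sum_eq_one, one_kronecker_one]

/-- The channel with an isometry as its only Kraus operator. -/
@[simps]
def ofIsometry [Fintype n] (V : LocalIsometry m n) : KrausFamily Unit m n where
  op _ := V.mat
  sum_eq_one := by simp [V.isometry]

variable (n) in
/-- The channel that does nothing. -/
@[simps]
def id [Fintype n] : KrausFamily Unit n n where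
  op _ := 1
  sum_eq_one := by simp

/-- The channel `W` followed by the isometry `V`. -/
@[simps]
def isometryComp [DecidableEq m] (V : LocalIsometry k m) (W : KrausFamily ε m n) :
    KrausFamily ε k n where
  op e := V.mat * W.op e
  sum_eq_one := by
    rw [← W.sum_eq_one]
    refine Finset.sum_congr rfl fun e _ => ?_
    rw [conjTranspose_mul, Matrix.mul_assoc, ← Matrix.mul_assoc _ V.mat, V.isometry,
      Matrix.one_mul]

/-- Relabelling the basis of the output register. -/
@[simps]
def reindex (e : m' ≃ m) (W : KrausFamily ε m n) : KrausFamily ε m' n where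
  op i := (W.op i).submatrix e _root_.id
  sum_eq_one := by
    rw [← W.sum_eq_one]
    refine Finset.sum_congr rfl fun i _ => ?_
    rw [conjTranspose_submatrix, submatrix_mul_equiv, submatrix_id_id]

theorem pullback_ofIsometry [Fintype n] (V : LocalIsometry m n) (E : Matrix m m ℂ) :
    (ofIsometry V).pullback E = QComm.pullback V.mat E := by
  simp [pullback]

theorem pullback_one [DecidableEq m] (W : KrausFamily ε m n) : W.pullback 1 = 1 := by
  simp only [pullback, QComm.pullback, Matrix.mul_one, W.sum_eq_one]

theorem pullback_add (W : KrausFamily ε m n) (E F : Matrix m m ℂ) :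
    W.pullback (E + F) = W.pullback E + W.pullback F := by
  simp only [pullback, QComm.pullback_add, Finset.sum_add_distrib]

theorem pullback_tensor (A : KrausFamily ε m n) (B : KrausFamily ε' m' n') (E : Matrix m m ℂ)
    (F : Matrix m' m' ℂ) : (A.tensor B).pullback (E ⊗ₖ F) = A.pullback E ⊗ₖ B.pullback F := by
  simp only [pullback, tensor_op, pullback_kronecker, Fintype.sum_prod_type, sum_kronecker_sum]

theorem trace_pullback [Fintype n] (W : KrausFamily ε m n) (E : Matrix m m ℂ) :
    (W.pullback E).trace = (E * ∑ e, W.op e * (W.op e)ᴴ).trace := by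
  rw [pullback, trace_sum, Matrix.mul_sum, trace_sum]
  refine Finset.sum_congr rfl fun e _ => ?_
  rw [← Matrix.mul_one (QComm.pullback _ _), trace_pullback_mul, Matrix.mul_one]

section Compression

variable [DecidableEq κ] [DecidableEq β] [DecidableEq r]

theorem isometry_of_eq_one_kronecker_mul {A : KrausFamily ε (κ × b) β} {W : KrausFamily ε b r}
    {V : Matrix (κ × r) β ℂ} (h : ∀ e, A.op e = ((1 : Matrix κ κ ℂ) ⊗ₖ W.op e) * V) :
    Vᴴ * V = 1 := by
  let W' := (id κ).tensor W
  calc Vᴴ * V = QComm.pullback V (∑ e, (W'.op e)ᴴ * W'.op e) := by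
        rw [W'.sum_eq_one, QComm.pullback, Matrix.mul_one]
    _ = ∑ e, (A.op e)ᴴ * A.op e := by
        simp [h, W', QComm.pullback, Fintype.sum_prod_type, Matrix.mul_sum, Matrix.sum_mul,
          Matrix.mul_assoc]
    _ = 1 := A.sum_eq_one

/-- The joint operator `b × ε ← κ × β` formed by the Kraus operators has rank at most `card r`, so
its range embeds isometrically into a register `r`. -/
theorem exists_compression [Fintype β] (A : KrausFamily ε (κ × b) β)
    (hr : min (Fintype.card (b × ε)) (Fintype.card (κ × β)) = Fintype.card r) :
    ∃ (V : LocalIsometry (κ × r) β) (W : KrausFamily ε b r),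
      ∀ e, A.op e = ((1 : Matrix κ κ ℂ) ⊗ₖ W.op e) * V.mat := by
  let M : Matrix (b × ε) (κ × β) ℂ := .of fun i j => A.op i.2 (j.1, i.1) j.2
  obtain ⟨W₀, hW₀, hM⟩ : ∃ W₀ : Matrix (b × ε) r ℂ, W₀ᴴ * W₀ = 1 ∧ W₀ * (W₀ᴴ * M) = M :=
    exists_isometry_of_rank_le
      (hr ▸ le_min (rank_le_card_height M) (rank_le_card_width M)) (hr ▸ min_le_left _ _)
  let V : Matrix (κ × r) β ℂ := .of fun i j => (W₀ᴴ * M) i.2 (i.1, j)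
  let W : KrausFamily ε b r :=
    { op := fun e => W₀.submatrix (fun i => (i, e)) _root_.id
      sum_eq_one := by
        rw [← hW₀]
        ext i j
        simp only [Matrix.sum_apply, mul_apply, Fintype.sum_prod_type, conjTranspose_apply,
          submatrix_apply, _root_.id]
        exact Finset.sum_comm }
  have hA : ∀ e, A.op e = ((1 : Matrix κ κ ℂ) ⊗ₖ W.op e) * V := by
    intro e
    ext ⟨k, i⟩ j
    calc A.op e (k, i) j = (W₀ * (W₀ᴴ * M)) (i, e) (k, j) := by rw [hM]; rfl
      _ = (((1 : Matrix κ κ ℂ) ⊗ₖ W.op e) * V) (k, i) j := by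
        simp [mul_apply (M := W₀), mul_apply (M := _ ⊗ₖ _), Fintype.sum_prod_type, one_apply, V, W,
          Finset.sum_ite_irrel]
  exact ⟨⟨V, isometry_of_eq_one_kronecker_mul hA⟩, W, hA⟩

theorem exists_compression_right [Fintype β] (A : KrausFamily ε (b × κ) β)
    (hr : min (Fintype.card (b × ε)) (Fintype.card (κ × β)) = Fintype.card r) :
    ∃ (V : LocalIsometry (r × κ) β) (W : KrausFamily ε b r),
      ∀ e, A.op e = (W.op e ⊗ₖ (1 : Matrix κ κ ℂ)) * V.mat := by
  obtain ⟨V, W, h⟩ := (A.reindex (Equiv.prodComm κ b)).exists_compression hr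
  refine ⟨V.reindex (Equiv.prodComm r κ) (Equiv.refl β), W, fun e => ?_⟩
  ext ⟨i, k⟩ j
  calc A.op e (i, k) j = (((1 : Matrix κ κ ℂ) ⊗ₖ W.op e) * V.mat) (k, i) j := by rw [← h]; rfl
    _ = ((W.op e ⊗ₖ (1 : Matrix κ κ ℂ)) * (V.reindex (Equiv.prodComm r κ) (.refl β)).mat)
          (i, k) j := by
      simp only [mul_apply, kroneckerMap_apply, Fintype.sum_prod_type_right (α₁ := r),
        Fintype.sum_prod_type (α₁ := κ), LocalIsometry.reindex_mat, submatrix_apply,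
        Equiv.prodComm_apply, Prod.swap, mul_comm (W.op e _ _), Equiv.refl_apply]

end Compression

section TrivialMessage

variable [Unique κ] [DecidableEq κ]

theorem exists_eq_one_kronecker_mul [Fintype n] (A : KrausFamily ε (κ × b) n) :
    ∃ W : KrausFamily ε b n, ∀ e, A.op e =
      ((1 : Matrix κ κ ℂ) ⊗ₖ W.op e) *
        ((LocalIsometry.id n).reindex (Equiv.uniqueProd n κ) (Equiv.refl n)).mat := by
  refine ⟨A.reindex (Equiv.uniqueProd b κ).symm, fun e => ?_⟩
  ext ⟨k, i⟩ j
  obtain rfl := Subsingleton.elim k default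
  simp [mul_apply, Fintype.sum_prod_type, one_apply]

theorem exists_eq_kronecker_one_mul [Fintype n] (A : KrausFamily ε (b × κ) n) :
    ∃ W : KrausFamily ε b n, ∀ e, A.op e =
      (W.op e ⊗ₖ (1 : Matrix κ κ ℂ)) *
        ((LocalIsometry.id n).reindex (Equiv.prodUnique n κ) (Equiv.refl n)).mat := by
  refine ⟨A.reindex (Equiv.prodUnique b κ).symm, fun e => ?_⟩
  ext ⟨i, k⟩ j
  obtain rfl := Subsingleton.elim k default
  simp [mul_apply, Fintype.sum_prod_type, one_apply]

end TrivialMessage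

end KrausFamily

open scoped MatrixOrder Matrix.Norms.L2Operator in
theorem DensityMatrix.exists_kraus {n : Type} [Fintype n] (ρ : DensityMatrix n) :
    ∃ W : KrausFamily n n (Fin 1), ∑ e, W.op e * (W.op e)ᴴ = ρ.mat := by
  classical
  obtain ⟨B, hB⟩ := (CStarAlgebra.nonneg_iff_eq_star_mul_self (a := ρ.mat)).1 ρ.posSemidef.nonneg
  rw [star_eq_conjTranspose] at hB
  refine ⟨⟨fun e => .of fun i _ => Bᴴ i e, ?_⟩, ?_⟩
  · ext i j
    have htr : ∑ i, ∑ e, Bᴴ i e * B e i = 1 := by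
      simpa only [hB, Matrix.trace, diag_apply, mul_apply] using ρ.trace_eq_one
    rw [Subsingleton.elim i j, one_apply_eq, ← htr, Finset.sum_comm]
    simp [Matrix.sum_apply, mul_apply, mul_comm]
  · refine .trans ?_ hB.symm
    ext i j
    simp [Matrix.sum_apply, mul_apply]

namespace Measurement

variable {m n : Type} [Fintype m] [DecidableEq m] [Fintype n] [DecidableEq n]

/-- The measurement that first sends the register through the channel `W`. -/
@[simps]
def precomp {ε : Type} [Fintype ε] (E : Measurement m) (W : KrausFamily ε m n) :
    Measurement n where
  effect z := W.pullback (E.effect z)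
  posSemidef z := posSemidef_sum _ fun e _ => (E.posSemidef z).conjTranspose_mul_mul_same (W.op e)
  sum_eq_one := by rw [← W.pullback_add, E.sum_eq_one, W.pullback_one]

/-- The measurement of the second part of a bipartite register. -/
@[simps]
def tensorLeft (α : Type) [Fintype α] [DecidableEq α] (E : Measurement n) :
    Measurement (α × n) where
  effect z := (1 : Matrix α α ℂ) ⊗ₖ E.effect z
  posSemidef z := PosSemidef.one.kronecker (E.posSemidef z)
  sum_eq_one := by rw [← kronecker_add, E.sum_eq_one, one_kronecker_one]

theorem exists_pullback_effect_eq (E : Measurement n) (J : LocalIsometry m n) :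
    ∃ E' : Measurement m, ∀ z, pullback J.mat (E'.effect z) = E.effect z := by
  let P := J.mat * J.matᴴ
  have hP : P * P = P := by
    simp only [P, Matrix.mul_assoc]
    rw [← Matrix.mul_assoc J.matᴴ, J.isometry, Matrix.one_mul]
  have hPJ : P * J.mat = J.mat := by rw [Matrix.mul_assoc, J.isometry, Matrix.mul_one]
  have hcompl : (1 - P).PosSemidef := by
    have h : (1 - P)ᴴ * (1 - P) = 1 - P := by
      simp [P, Matrix.mul_sub, Matrix.sub_mul, hP]
    exact h ▸ posSemidef_conjTranspose_mul_self _
  have hpull (F : Matrix n n ℂ) : pullback J.mat (pullback J.matᴴ F) = F := by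
    rw [pullback_pullback, J.isometry, pullback, conjTranspose_one, Matrix.one_mul, Matrix.mul_one]
  refine ⟨⟨fun z => pullback J.matᴴ (E.effect z) + if z then 0 else 1 - P, fun z => ?_, ?_⟩,
    fun z => ?_⟩
  · refine ((E.posSemidef z).conjTranspose_mul_mul_same J.matᴴ).add ?_
    cases z
    · exact hcompl
    · exact .zero
  · simp only [Bool.false_eq_true, if_false, if_true, add_zero]
    rw [add_right_comm, ← pullback_add, E.sum_eq_one, pullback, conjTranspose_conjTranspose,
      Matrix.mul_one, add_sub_cancel]
  · have hz : pullback J.mat (1 - P) = 0 := by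
      rw [pullback, Matrix.mul_assoc, Matrix.sub_mul, hPJ, Matrix.one_mul, sub_self,
        Matrix.mul_zero]
    rw [pullback_add, hpull]
    cases z
    · simp [hz]
    · simp [pullback]

end Measurement

section Sending

variable {a b a₀ b₀ κ α β α' β' εA εB : Type} [Fintype a] [Fintype b] [Fintype a₀] [Fintype b₀]
  [Fintype κ] [Fintype α] [Fintype β] [Fintype α'] [Fintype β'] [Fintype εA] [Fintype εB]
  [DecidableEq a₀] [DecidableEq b₀] [DecidableEq α] [DecidableEq β] [DecidableEq κ]

variable (a) in
/-- Bob applies `V` and hands the register `κ` over to Alice, who holds the register `a`. -/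
def bobSend [DecidableEq a] (V : LocalIsometry (κ × b) b₀) : LocalIsometry ((a × κ) × b) (a × b₀) :=
  ((LocalIsometry.id a).tensor V).reindex (Equiv.prodAssoc a κ b) (Equiv.refl _)

variable (b) in
/-- Alice applies `U` and hands the register `κ` over to Bob, who holds the register `b`. -/
def aliceSend [DecidableEq b] (U : LocalIsometry (a × κ) a₀) :
    LocalIsometry (a × (κ × b)) (a₀ × b) :=
  (U.tensor (LocalIsometry.id b)).reindex (Equiv.prodAssoc a κ b).symm (Equiv.refl _)

theorem bobSend_mul_kronecker [DecidableEq a] {V : LocalIsometry (κ × b) b₀} {B : Matrix b₀ β ℂ}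
    {B' : Matrix b β' ℂ} {V' : LocalIsometry (κ × β') β} (A : Matrix a α ℂ)
    (h : V.mat * B = ((1 : Matrix κ κ ℂ) ⊗ₖ B') * V'.mat) :
    (bobSend a V).mat * (A ⊗ₖ B) = ((A ⊗ₖ (1 : Matrix κ κ ℂ)) ⊗ₖ B') * (bobSend α V').mat := by
  have hV : (bobSend a V).mat * (A ⊗ₖ B) =
      (A ⊗ₖ (V.mat * B)).submatrix (Equiv.prodAssoc a κ b) id := by
    rw [← Matrix.one_mul A, mul_kronecker_mul, Matrix.one_mul]
    rfl
  have hassoc : (A ⊗ₖ (1 : Matrix κ κ ℂ)) ⊗ₖ B' = (A ⊗ₖ ((1 : Matrix κ κ ℂ) ⊗ₖ B')).submatrix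
      (Equiv.prodAssoc a κ b) (Equiv.prodAssoc α κ β') := by
    ext
    simp [mul_assoc]
  rw [hV, h, ← Matrix.mul_one A, mul_kronecker_mul, Matrix.mul_one, hassoc, bobSend,
    LocalIsometry.reindex_mat, submatrix_mul_equiv]
  rfl

theorem aliceSend_mul_kronecker [DecidableEq b] {U : LocalIsometry (a × κ) a₀} {A : Matrix a₀ α ℂ}
    {A' : Matrix a α' ℂ} {U' : LocalIsometry (α' × κ) α} (B : Matrix b β ℂ)
    (h : U.mat * A = (A' ⊗ₖ (1 : Matrix κ κ ℂ)) * U'.mat) :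
    (aliceSend b U).mat * (A ⊗ₖ B) =
      (A' ⊗ₖ ((1 : Matrix κ κ ℂ) ⊗ₖ B)) * (aliceSend β U').mat := by
  have hU : (aliceSend b U).mat * (A ⊗ₖ B) =
      ((U.mat * A) ⊗ₖ B).submatrix (Equiv.prodAssoc a κ b).symm id := by
    rw [← Matrix.one_mul B, mul_kronecker_mul, Matrix.one_mul]
    rfl
  have hassoc : A' ⊗ₖ ((1 : Matrix κ κ ℂ) ⊗ₖ B) = ((A' ⊗ₖ (1 : Matrix κ κ ℂ)) ⊗ₖ B).submatrix
      (Equiv.prodAssoc a κ b).symm (Equiv.prodAssoc α' κ β).symm := by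
    ext
    simp [mul_assoc]
  rw [hU, h, ← Matrix.mul_one B, mul_kronecker_mul, Matrix.mul_one, hassoc, aliceSend,
    LocalIsometry.reindex_mat, submatrix_mul_equiv]
  rfl

theorem pullback_tensor_pullback_bobSend [DecidableEq a] [DecidableEq β']
    {V : LocalIsometry (κ × b) b₀} {WB : KrausFamily εB b₀ β} {WB' : KrausFamily εB b β'}
    {V' : LocalIsometry (κ × β') β}
    (WA : KrausFamily εA a α)
    (h : ∀ e, V.mat * WB.op e = ((1 : Matrix κ κ ℂ) ⊗ₖ WB'.op e) * V'.mat)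
    (O : Matrix ((a × κ) × b) ((a × κ) × b) ℂ) :
    (WA.tensor WB).pullback (pullback (bobSend a V).mat O) =
      pullback (bobSend α V').mat (((WA.tensor (.id κ)).tensor WB').pullback O) := by
  simp [KrausFamily.pullback, pullback_sum, pullback_pullback, Fintype.sum_prod_type,
    bobSend_mul_kronecker _ (h _)]

theorem pullback_tensor_pullback_aliceSend [DecidableEq b] [DecidableEq α']
    {U : LocalIsometry (a × κ) a₀} {WA : KrausFamily εA a₀ α} {WA' : KrausFamily εA a α'}
    {U' : LocalIsometry (α' × κ) α}
    (WB : KrausFamily εB b β)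
    (h : ∀ e, U.mat * WA.op e = (WA'.op e ⊗ₖ (1 : Matrix κ κ ℂ)) * U'.mat)
    (O : Matrix (a × (κ × b)) (a × (κ × b)) ℂ) :
    (WA.tensor WB).pullback (pullback (aliceSend b U).mat O) =
      pullback (aliceSend β U').mat ((WA'.tensor ((KrausFamily.id κ).tensor WB)).pullback O) := by
  simp [KrausFamily.pullback, pullback_sum, pullback_pullback, Fintype.sum_prod_type,
    aliceSend_mul_kronecker _ (h _)]

theorem onAlice_mul_onBob {a q b q' b' a' q'' : ℕ}
    (U : LocalIsometry (Fin a' × Qubits q'') (Fin a × Qubits q'))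
    (V : LocalIsometry (Qubits q' × Fin b') (Qubits q × Fin b)) :
    onAlice b' U.mat * onBob a V.mat =
      (aliceSend (Fin b') U).mat * (bobSend (Fin a) V).mat := by
  have hU : onAlice b' U.mat = (aliceSend (Fin b') U).mat.submatrix id
      (Equiv.prodAssoc (Fin a) (Qubits q') (Fin b')).symm := rfl
  have hV : onBob a V.mat = (bobSend (Fin a) V).mat.submatrix
      (Equiv.prodAssoc (Fin a) (Qubits q') (Fin b')).symm id := rfl
  rw [hU, hV, submatrix_mul_equiv, submatrix_id_id]

end Sending

variable {X Y : Type*}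

theorem onBob_pullback {q b q' b' : ℕ} (a : ℕ)
    (A : Matrix (Qubits q' × Fin b') (Qubits q × Fin b) ℂ)
    (E : Matrix (Qubits q' × Fin b') (Qubits q' × Fin b') ℂ) :
    onBob a (pullback A E) = pullback (onBob a A) (onBob a E) := by
  have h : pullback (1 : Matrix (Fin a) (Fin a) ℂ) 1 = 1 := by simp [pullback]
  rw [onBob, onBob, onBob, pullback_kronecker, h]

theorem onBob_mul {q b q' b' q'' b'' : ℕ} (a : ℕ)
    (V : Matrix (Qubits q'' × Fin b'') (Qubits q' × Fin b') ℂ)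
    (A : Matrix (Qubits q' × Fin b') (Qubits q × Fin b) ℂ) :
    onBob a (V * A) = onBob a V * onBob a A := by
  rw [onBob, onBob, onBob, ← mul_kronecker_mul, Matrix.one_mul]

theorem onBob_one (a q b : ℕ) :
    onBob a (1 : Matrix (Qubits q × Fin b) (Qubits q × Fin b) ℂ) = 1 := one_kronecker_one

theorem exists_onBob_effect_eq {N : ℕ} (E : Measurement (Joint 1 N 1)) :
    ∃ E' : Measurement (Qubits N × Fin 1), ∀ z, onBob 1 (E'.effect z) = E.effect z := by
  let e := Equiv.uniqueProd (Qubits N × Fin 1) (Fin 1)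
  refine ⟨⟨fun z => (E.effect z).submatrix e.symm e.symm,
    fun z => (E.posSemidef z).submatrix e.symm, ?_⟩, fun z => ?_⟩
  · change (E.effect false + E.effect true).submatrix e.symm e.symm = 1
    rw [E.sum_eq_one, submatrix_one_equiv]
  · ext ⟨i, i'⟩ ⟨j, j'⟩
    obtain rfl := Subsingleton.elim i j
    simp [onBob, e, Subsingleton.elim i 0]

theorem exists_onBob_mat_eq {N N' : ℕ} (A : LocalIsometry (Joint 1 N' 1) (Joint 1 N 1)) :
    ∃ V : LocalIsometry (Qubits N' × Fin 1) (Qubits N × Fin 1), onBob 1 V.mat = A.mat := by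
  refine ⟨A.reindex (Equiv.uniqueProd (Qubits N' × Fin 1) (Fin 1)).symm
    (Equiv.uniqueProd (Qubits N × Fin 1) (Fin 1)).symm, ?_⟩
  ext ⟨i, i'⟩ ⟨j, j'⟩
  obtain rfl := Subsingleton.elim i j
  simp [onBob, Subsingleton.elim i 0]

theorem exists_onAlice_mat_eq {N N' : ℕ} (A : LocalIsometry (Joint 1 N' 1) (Joint 1 N 1)) :
    ∃ U : LocalIsometry (Fin 1 × Qubits N') (Fin 1 × Qubits N), onAlice 1 U.mat = A.mat := by
  refine ⟨A.reindex
    ((Equiv.prodUnique (Fin 1 × Qubits N') (Fin 1)).symm.trans (Equiv.prodAssoc _ _ _))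
    ((Equiv.prodUnique (Fin 1 × Qubits N) (Fin 1)).symm.trans (Equiv.prodAssoc _ _ _)), ?_⟩
  ext ⟨i, i', i''⟩ ⟨j, j', j''⟩
  obtain rfl := Subsingleton.elim i'' j''
  simp [onAlice, Subsingleton.elim i'' 0]

namespace Continuation

/-- The Heisenberg picture of a continuation: the effect on the current joint state whose
probability is that of the output `z`. -/
noncomputable def effect (x : X) (y : Y) (z : Bool) {a q b : ℕ} :
    Continuation X Y a q b → Matrix (Joint a q b) (Joint a q b) ℂ
  | measure E => onBob a ((E y).effect z)
  | round V U rest =>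
      pullback (bobSend (Fin a) (V y)).mat
        (pullback (aliceSend (Fin _) (U x)).mat (rest.effect x y z))

theorem effect_round (x : X) (y : Y) (z : Bool) {a q b q' b' a' q'' : ℕ}
    (V : Y → LocalIsometry (Qubits q' × Fin b') (Qubits q × Fin b))
    (U : X → LocalIsometry (Fin a' × Qubits q'') (Fin a × Qubits q'))
    (rest : Continuation X Y a' q'' b') :
    (round V U rest).effect x y z =
      pullback (onAlice b' (U x).mat * onBob a (V y).mat) (rest.effect x y z) := by
  rw [onAlice_mul_onBob, ← pullback_pullback]
  rfl

theorem outputProb_eq_trace_effect (x : X) (y : Y) (z : Bool) {a q b : ℕ}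
    (c : Continuation X Y a q b) (ρ : Matrix (Joint a q b) (Joint a q b) ℂ) :
    c.outputProb x y z ρ = (c.effect x y z * ρ).trace.re := by
  induction c with
  | measure E => rfl
  | round V U rest ih => rw [outputProb, ih, effect_round, trace_pullback_mul]

/-- The continuation in which Bob first applies `A y` to the message and his memory. -/
def precomp {a q b q₀ b₀ : ℕ} (A : Y → LocalIsometry (Qubits q × Fin b) (Qubits q₀ × Fin b₀)) :
    Continuation X Y a q b → Continuation X Y a q₀ b₀
  | measure E => measure fun y => (E y).precomp (.ofIsometry (A y))
  | round V U rest => round (fun y => (V y).comp (A y)) U rest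

variable {a q b q₀ b₀ : ℕ} (A : Y → LocalIsometry (Qubits q × Fin b) (Qubits q₀ × Fin b₀))
  (c : Continuation X Y a q b)

theorem cost_precomp : (c.precomp A).cost = c.cost := by cases c <;> rfl

theorem memoryless_precomp_iff : (c.precomp A).Memoryless ↔ c.Memoryless := by cases c <;> rfl

theorem effect_precomp (x : X) (y : Y) (z : Bool) :
    (c.precomp A).effect x y z = pullback (onBob a (A y).mat) (c.effect x y z) := by
  cases c with
  | measure E =>
    simp only [precomp, effect, Measurement.precomp_effect, KrausFamily.pullback_ofIsometry,
      onBob_pullback]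
  | round V U rest =>
    rw [precomp, effect_round, effect_round, pullback_pullback, LocalIsometry.comp_mat, onBob_mul,
      Matrix.mul_assoc]

end Continuation

section Realizability

variable {n n' : Type} [Fintype n] [DecidableEq n] [Fintype n'] [DecidableEq n']
  {O : X → Y → Bool → Matrix n n ℂ} {m m' T : ℕ}

/-- A memoryless protocol measures the effects `O x y z` on a register `n` held by Alice: she
encodes it into a message of at least `m` qubits to Bob, and `T` qubits are communicated in total,
this message included. -/
def AliceRealizes (O : X → Y → Bool → Matrix n n ℂ) (m T : ℕ) : Prop :=
  ∃ (M : ℕ) (U : X → LocalIsometry (Joint 1 M 1) n) (c : Continuation X Y 1 M 1),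
    m ≤ M ∧ c.Memoryless ∧ M + c.cost = T ∧
      ∀ x y z, O x y z = pullback (U x).mat (c.effect x y z)

/-- A memoryless protocol measures the effects `O x y z` on a register `n` that has arrived at Bob
in a message of at least `m` qubits, encoded independently of the inputs. Only `m` of these qubits
are free of charge, and `T` qubits are communicated otherwise. -/
def BobRealizes (O : X → Y → Bool → Matrix n n ℂ) (m T : ℕ) : Prop :=
  ∃ (M : ℕ) (J : LocalIsometry (Joint 1 M 1) n) (c : Continuation X Y 1 M 1),
    m ≤ M ∧ c.Memoryless ∧ M + c.cost = m + T ∧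
      ∀ x y z, O x y z = pullback J.mat (c.effect x y z)

theorem card_joint_one_one (N : ℕ) : Fintype.card (Joint 1 N 1) = 2 ^ N := by simp

theorem AliceRealizes.comp (h : AliceRealizes O m T) (K : X → LocalIsometry n n') (hm : m' ≤ m) :
    AliceRealizes (fun x y z => pullback (K x).mat (O x y z)) m' T := by
  obtain ⟨M, U, c, hM, hc, hT, hO⟩ := h
  refine ⟨M, fun x => (U x).comp (K x), c, hm.trans hM, hc, hT, fun x y z => ?_⟩
  simp only [hO, pullback_pullback, LocalIsometry.comp_mat]

theorem BobRealizes.comp (h : BobRealizes O m T) (K : Y → LocalIsometry n n') (hm : m' ≤ m)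
    (hn' : Fintype.card n' ≤ 2 ^ m') :
    BobRealizes (fun x y z => pullback (K y).mat (O x y z)) m' T := by
  obtain ⟨M, J, c, hM, hc, hT, hO⟩ := h
  let M' := M - (m - m')
  obtain ⟨J'⟩ : Nonempty (LocalIsometry (Joint 1 M' 1) n') := by
    refine LocalIsometry.nonempty_of_card_le (hn'.trans ?_)
    rw [card_joint_one_one]
    exact Nat.pow_le_pow_right two_pos (by omega)
  have hM' : Fintype.card (Joint 1 M' 1) ≤ Fintype.card (Joint 1 M 1) := by
    simp only [card_joint_one_one]
    exact Nat.pow_le_pow_right two_pos (by omega)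
  choose A hA using fun y => J'.exists_extension (J.comp (K y)) hM'
  choose V hV using fun y => exists_onBob_mat_eq (A y)
  refine ⟨M', J', c.precomp V, by omega, (c.memoryless_precomp_iff V).2 hc, ?_, fun x y z => ?_⟩
  · rw [c.cost_precomp]
    omega
  · simp only [hO, c.effect_precomp, hV, pullback_pullback, hA, LocalIsometry.comp_mat]

theorem BobRealizes.toAlice (h : BobRealizes O m T) : AliceRealizes O m (m + T) :=
  let ⟨M, J, c, hM, hc, hT, hO⟩ := h
  ⟨M, fun _ => J, c, hM, hc, hT, hO⟩

/-- Bob returns the message to Alice at once. -/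
theorem AliceRealizes.toBob (h : AliceRealizes O m T) (hn : Fintype.card n ≤ 2 ^ m) :
    BobRealizes O m (m + T) := by
  obtain ⟨M, U, c, hM, hc, hT, hO⟩ := h
  obtain ⟨J⟩ : Nonempty (LocalIsometry (Joint 1 m 1) n) :=
    LocalIsometry.nonempty_of_card_le (hn.trans_eq (card_joint_one_one m).symm)
  have hmM : Fintype.card (Joint 1 m 1) ≤ Fintype.card (Joint 1 M 1) := by
    simp only [card_joint_one_one]
    exact Nat.pow_le_pow_right two_pos hM
  choose A hA using fun x => J.exists_extension (U x) hmM
  choose U' hU' using fun x => exists_onAlice_mat_eq (A x)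
  refine ⟨m, J, .round (fun _ => .id _) U' c, le_rfl, ⟨rfl, rfl, hc⟩, ?_, fun x y z => ?_⟩
  · simp only [Continuation.cost]
    omega
  · rw [hO, Continuation.effect_round, hU', LocalIsometry.id_mat, onBob_one, Matrix.mul_one,
      pullback_pullback, hA]

theorem BobRealizes.of_measurement (E : Y → Measurement n) (hn : Fintype.card n ≤ 2 ^ m) (T : ℕ) :
    BobRealizes (fun (_ : X) y z => (E y).effect z) m T := by
  obtain ⟨J⟩ : Nonempty (LocalIsometry (Joint 1 (m + T) 1) n) := by
    refine LocalIsometry.nonempty_of_card_le (hn.trans ?_)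
    rw [card_joint_one_one]
    exact Nat.pow_le_pow_right two_pos (by omega)
  choose E' hE' using fun y => (E y).exists_pullback_effect_eq J
  choose F hF using fun y => exists_onBob_effect_eq (E' y)
  exact ⟨m + T, J, .measure F, by omega, trivial, rfl, fun x y z => by
    rw [Continuation.effect, hF, hE']⟩

end Realizability

theorem Protocol.firstState_eq (P : Protocol X Y) (x : X) :
    P.firstState x = (aliceSend (Fin P.b₀) (P.U₁ x)).mat * (P.ρA.mat ⊗ₖ P.ρB.mat) *
      (aliceSend (Fin P.b₀) (P.U₁ x)).matᴴ := by
  have h : ((P.U₁ x).mat ⊗ₖ (1 : Matrix (Fin P.b₀) (Fin P.b₀) ℂ)) * (P.ρA.mat ⊗ₖ P.ρB.mat) *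
        ((P.U₁ x).mat ⊗ₖ (1 : Matrix (Fin P.b₀) (Fin P.b₀) ℂ))ᴴ =
      ((P.U₁ x).mat * P.ρA.mat * (P.U₁ x).matᴴ) ⊗ₖ P.ρB.mat := by
    rw [conjTranspose_kronecker, ← mul_kronecker_mul, ← mul_kronecker_mul, conjTranspose_one,
      Matrix.one_mul, Matrix.mul_one]
  rw [Protocol.firstState, ← h]
  rfl

theorem Protocol.outputProb_eq_trace_pullback (P : Protocol X Y) (x : X) (y : Y) (z : Bool) :
    P.outputProb x y z =
      (pullback (aliceSend (Fin P.b₀) (P.U₁ x)).mat (P.rest.effect x y z) *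
        (P.ρA.mat ⊗ₖ P.ρB.mat)).trace.re := by
  rw [Protocol.outputProb, Continuation.outputProb_eq_trace_effect, Protocol.firstState_eq,
    trace_pullback_mul]

/-- The state of a one-dimensional register. -/
@[simps]
def trivialState : DensityMatrix (Fin 1) where
  mat := 1
  posSemidef := .one
  trace_eq_one := by simp

theorem AliceRealizes.exists_protocol {O : X → Y → Bool → Matrix (Fin 1 × Fin 1) (Fin 1 × Fin 1) ℂ}
    {m T : ℕ} (h : AliceRealizes O m T) :
    ∃ P : Protocol X Y, P.Memoryless ∧ P.cost = T ∧
      ∀ x y z, P.outputProb x y z = (O x y z).trace.re := by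
  obtain ⟨M, U, c, -, hc, hT, hO⟩ := h
  let e : Fin 1 × Qubits M ≃ Joint 1 M 1 :=
    (Equiv.prodUnique (Fin 1 × Qubits M) (Fin 1)).symm.trans (Equiv.prodAssoc _ _ _)
  let U₁ (x : X) : LocalIsometry (Fin 1 × Qubits M) (Fin 1) :=
    (U x).reindex e (Equiv.uniqueProd (Fin 1) (Fin 1)).symm
  have hU₁ (x : X) : (aliceSend (Fin 1) (U₁ x)).mat = (U x).mat := by
    ext ⟨i, i', i''⟩ ⟨j, j'⟩
    obtain rfl := Subsingleton.elim i'' j'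
    simp [aliceSend, U₁, e, Subsingleton.elim i'' 0, Subsingleton.elim j 0]
  refine ⟨⟨1, 1, trivialState, trivialState, M, 1, U₁, c⟩, ⟨rfl, rfl, rfl, hc⟩, hT,
    fun x y z => ?_⟩
  rw [Protocol.outputProb_eq_trace_pullback, hU₁, ← hO, trivialState_mat, one_kronecker_one,
    Matrix.mul_one]

section Simulability

variable {a b a₀ b₀ κ : Type} [Fintype a] [Fintype b] [Fintype κ]

/-- Suppose that Alice and Bob obtain the register `a × b` from registers of at most `s` qubits
each, by local channels depending on their inputs. Whichever party is given the two small registers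
can then have the effects `O x y z` measured by a memoryless protocol with `T` qubits of
communication, as soon as `T` is at least the threshold `τ s`. -/
def Simulable (O : X → Y → Bool → Matrix (a × b) (a × b) ℂ) (τ : ℕ → ℕ) : Prop :=
  ∀ ⦃α β εA εB : Type⦄ [Fintype α] [DecidableEq α] [Fintype β] [DecidableEq β] [Fintype εA]
    [Fintype εB] (WA : X → KrausFamily εA a α) (WB : Y → KrausFamily εB b β) ⦃s T : ℕ⦄,
    Fintype.card α ≤ 2 ^ s → Fintype.card β ≤ 2 ^ s → τ s ≤ T →
      AliceRealizes (fun x y z => ((WA x).tensor (WB y)).pullback (O x y z)) (2 * s) T ∧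
        BobRealizes (fun x y z => ((WA x).tensor (WB y)).pullback (O x y z)) (2 * s) T

variable {O : X → Y → Bool → Matrix (a × b) (a × b) ℂ} {τ τ' : ℕ → ℕ}

theorem Simulable.mono (h : Simulable O τ) (hτ : ∀ s, τ s ≤ τ' s) : Simulable O τ' :=
  fun _ _ _ _ _ _ _ _ _ _ WA WB s _ hα hβ hT => h WA WB hα hβ ((hτ s).trans hT)

theorem card_prod_le_two_pow {α β : Type} [Fintype α] [Fintype β] {s t : ℕ}
    (hα : Fintype.card α ≤ 2 ^ s) (hβ : Fintype.card β ≤ 2 ^ t) :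
    Fintype.card (α × β) ≤ 2 ^ (s + t) := by
  rw [Fintype.card_prod, pow_add]
  exact Nat.mul_le_mul hα hβ

theorem card_prod_le_two_pow_two_mul {α β : Type} [Fintype α] [Fintype β] {s : ℕ}
    (hα : Fintype.card α ≤ 2 ^ s) (hβ : Fintype.card β ≤ 2 ^ s) :
    Fintype.card (α × β) ≤ 2 ^ (2 * s) :=
  two_mul s ▸ card_prod_le_two_pow hα hβ

theorem simulable_measure (a : ℕ) {q b : ℕ} (E : Y → Measurement (Qubits q × Fin b)) :
    Simulable (fun (_ : X) y z => onBob a ((E y).effect z)) (2 * ·) := by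
  intro α β εA εB _ _ _ _ _ _ WA WB s T hα hβ hT
  have hbob (T : ℕ) : BobRealizes
      (fun x y z => ((WA x).tensor (WB y)).pullback (onBob a ((E y).effect z))) (2 * s) T := by
    have h : (fun x y z => ((WA x).tensor (WB y)).pullback (onBob a ((E y).effect z))) =
        fun (_ : X) y z => (((E y).precomp (WB y)).tensorLeft α).effect z := by
      funext x y z
      rw [onBob, KrausFamily.pullback_tensor, KrausFamily.pullback_one]
      rfl
    exact h ▸ .of_measurement _ (card_prod_le_two_pow_two_mul hα hβ) T
  obtain ⟨t, rfl⟩ := Nat.exists_eq_add_of_le hT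
  exact ⟨(hbob t).toAlice, hbob _⟩

theorem Simulable.pullback_bobSend [DecidableEq a] [Fintype b₀] [DecidableEq b₀]
    {O : X → Y → Bool → Matrix ((a × κ) × b) ((a × κ) × b) ℂ} (h : Simulable O τ) {q : ℕ}
    (hq : Fintype.card κ ≤ 2 ^ q) (V : Y → LocalIsometry (κ × b) b₀) :
    Simulable (fun x y z => pullback (bobSend a (V y)).mat (O x y z))
      fun s => 2 * s + τ (s + q) := by
  classical
  rintro α β εA εB _ _ _ _ _ _ WA WB s T hα hβ (hT : 2 * s + τ (s + q) ≤ T)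
  let r := min (Fintype.card (b × εB)) (Fintype.card (κ × β))
  have hr : Fintype.card (Fin r) ≤ 2 ^ (s + q) := by
    rw [Fintype.card_fin, add_comm]
    exact (min_le_right _ _).trans (card_prod_le_two_pow hq hβ)
  choose V' WB' hV using fun y =>
    ((WB y).isometryComp (V y)).exists_compression (Fintype.card_fin r).symm
  have hbob {T : ℕ} (hT : τ (s + q) ≤ T) : BobRealizes (fun x y z =>
      ((WA x).tensor (WB y)).pullback (pullback (bobSend a (V y)).mat (O x y z))) (2 * s) T := by
    simp only [pullback_tensor_pullback_bobSend _ (hV _)]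
    exact (h (fun x => (WA x).tensor (.id κ)) WB' (card_prod_le_two_pow hα hq) hr hT).2.comp
      (fun y => bobSend α (V' y)) (by omega) (card_prod_le_two_pow_two_mul hα hβ)
  obtain ⟨t, rfl⟩ := Nat.exists_eq_add_of_le ((Nat.le_add_right _ _).trans hT)
  exact ⟨(hbob (by omega)).toAlice, hbob (by omega)⟩

theorem Simulable.pullback_aliceSend [DecidableEq b] [Fintype a₀] [DecidableEq a₀]
    {O : X → Y → Bool → Matrix (a × (κ × b)) (a × (κ × b)) ℂ} (h : Simulable O τ) {q : ℕ}
    (hq : Fintype.card κ ≤ 2 ^ q) (U : X → LocalIsometry (a × κ) a₀) :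
    Simulable (fun x y z => pullback (aliceSend b (U x)).mat (O x y z))
      fun s => 2 * s + τ (s + q) := by
  classical
  rintro α β εA εB _ _ _ _ _ _ WA WB s T hα hβ (hT : 2 * s + τ (s + q) ≤ T)
  let r := min (Fintype.card (a × εA)) (Fintype.card (κ × α))
  have hr : Fintype.card (Fin r) ≤ 2 ^ (s + q) := by
    rw [Fintype.card_fin, add_comm]
    exact (min_le_right _ _).trans (card_prod_le_two_pow hq hα)
  choose U' WA' hU using fun x =>
    ((WA x).isometryComp (U x)).exists_compression_right (Fintype.card_fin r).symm
  have halice {T : ℕ} (hT : τ (s + q) ≤ T) : AliceRealizes (fun x y z =>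
      ((WA x).tensor (WB y)).pullback (pullback (aliceSend b (U x)).mat (O x y z))) (2 * s) T := by
    simp only [pullback_tensor_pullback_aliceSend _ (hU _)]
    have hβ' : Fintype.card (κ × β) ≤ 2 ^ (s + q) := add_comm q s ▸ card_prod_le_two_pow hq hβ
    exact (h WA' (fun y => (KrausFamily.id κ).tensor (WB y)) hr hβ' hT).1.comp
      (fun x => aliceSend β (U' x)) (by omega)
  obtain ⟨t, rfl⟩ := Nat.exists_eq_add_of_le ((Nat.le_add_right _ _).trans hT)
  exact ⟨halice (by omega), (halice (by omega)).toBob (card_prod_le_two_pow_two_mul hα hβ)⟩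

/-- The operation that prepares an empty message is absorbed into Bob's channel. -/
theorem Simulable.pullback_bobSend_of_unique [Unique κ] [DecidableEq a] [Fintype b₀]
    [DecidableEq b₀] {O : X → Y → Bool → Matrix ((a × κ) × b) ((a × κ) × b) ℂ}
    (h : Simulable O τ) (V : Y → LocalIsometry (κ × b) b₀) :
    Simulable (fun x y z => pullback (bobSend a (V y)).mat (O x y z)) τ := by
  classical
  intro α β εA εB _ _ _ _ _ _ WA WB s T hα hβ hT
  choose WB' hV using fun y => ((WB y).isometryComp (V y)).exists_eq_one_kronecker_mul
  have hα' : Fintype.card (α × κ) ≤ 2 ^ s := by simpa using hα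
  obtain ⟨halice, hbob⟩ := h (fun x => (WA x).tensor (.id κ)) WB' hα' hβ hT
  simp only [pullback_tensor_pullback_bobSend _ (hV _)]
  exact ⟨halice.comp (fun _ => bobSend α _) le_rfl,
    hbob.comp (fun _ => bobSend α _) le_rfl (card_prod_le_two_pow_two_mul hα hβ)⟩

theorem Simulable.pullback_aliceSend_of_unique [Unique κ] [DecidableEq b] [Fintype a₀]
    [DecidableEq a₀] {O : X → Y → Bool → Matrix (a × (κ × b)) (a × (κ × b)) ℂ}
    (h : Simulable O τ) (U : X → LocalIsometry (a × κ) a₀) :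
    Simulable (fun x y z => pullback (aliceSend b (U x)).mat (O x y z)) τ := by
  classical
  intro α β εA εB _ _ _ _ _ _ WA WB s T hα hβ hT
  choose WA' hU using fun x => ((WA x).isometryComp (U x)).exists_eq_kronecker_one_mul
  have hβ' : Fintype.card (κ × β) ≤ 2 ^ s := by simpa using hβ
  obtain ⟨halice, hbob⟩ := h WA' (fun y => (KrausFamily.id κ).tensor (WB y)) hα hβ' hT
  simp only [pullback_tensor_pullback_aliceSend _ (hU _)]
  exact ⟨halice.comp (fun _ => aliceSend β _) le_rfl,
    hbob.comp (fun _ => aliceSend β _) le_rfl (card_prod_le_two_pow_two_mul hα hβ)⟩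

/-- The number of qubits that suffice to simulate the last `k` qubits of a protocol in which `s`
qubits have been sent before. It is the sum, over `0 ≤ j ≤ k`, of the size `2 * (s + j)` of the
compressed joint state after `j` more qubits. -/
def simulationCost (k s : ℕ) : ℕ := (k + 1) * (2 * s + k)

theorem two_mul_add_simulationCost_le {q : ℕ} (hq : q ≠ 0) (k s : ℕ) :
    2 * s + simulationCost k (s + q) ≤ simulationCost (k + q) s := by
  obtain ⟨p, rfl⟩ := Nat.exists_eq_succ_of_ne_zero hq
  simp only [simulationCost, Nat.succ_eq_add_one]
  nlinarith [Nat.zero_le (s * p), Nat.zero_le (p * p)]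

variable {k q : ℕ}

theorem Simulable.bobSend [DecidableEq a] [Fintype b₀] [DecidableEq b₀]
    {O : X → Y → Bool → Matrix ((a × Qubits q) × b) ((a × Qubits q) × b) ℂ}
    (h : Simulable O (simulationCost k)) (V : Y → LocalIsometry (Qubits q × b) b₀) :
    Simulable (fun x y z => pullback (bobSend a (V y)).mat (O x y z)) (simulationCost (k + q)) := by
  rcases eq_or_ne q 0 with rfl | hq
  · exact h.pullback_bobSend_of_unique V
  · exact (h.pullback_bobSend (by simp) V).mono (two_mul_add_simulationCost_le hq k)

theorem Simulable.aliceSend [DecidableEq b] [Fintype a₀] [DecidableEq a₀]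
    {O : X → Y → Bool → Matrix (a × (Qubits q × b)) (a × (Qubits q × b)) ℂ}
    (h : Simulable O (simulationCost k)) (U : X → LocalIsometry (a × Qubits q) a₀) :
    Simulable (fun x y z => pullback (aliceSend b (U x)).mat (O x y z))
      (simulationCost (k + q)) := by
  rcases eq_or_ne q 0 with rfl | hq
  · exact h.pullback_aliceSend_of_unique U
  · exact (h.pullback_aliceSend (by simp) U).mono (two_mul_add_simulationCost_le hq k)

end Simulability

theorem Continuation.simulable {a q b : ℕ} (c : Continuation X Y a q b) :
    Simulable (fun x y z => c.effect x y z) (simulationCost c.cost) := by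
  induction c with
  | measure E =>
    exact (simulable_measure _ E).mono fun s => by simp [simulationCost, Continuation.cost]
  | @round a q b q' b' a' q'' V U rest ih =>
    have hcost : (round V U rest).cost = rest.cost + q'' + q' := by
      simp only [Continuation.cost]
      omega
    exact hcost ▸ (ih.aliceSend U).bobSend V

theorem Protocol.outputProb_eq_trace_kraus (P : Protocol X Y)
    {εA εB : Type} [Fintype εA] [Fintype εB] {WA : KrausFamily εA (Fin P.a₀) (Fin 1)}
    {WB : KrausFamily εB (Fin P.b₀) (Fin 1)} (hA : ∑ e, WA.op e * (WA.op e)ᴴ = P.ρA.mat)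
    (hB : ∑ e, WB.op e * (WB.op e)ᴴ = P.ρB.mat) (x : X) (y : Y) (z : Bool) :
    P.outputProb x y z = ((WA.tensor WB).pullback
      (pullback (aliceSend (Fin P.b₀) (P.U₁ x)).mat (P.rest.effect x y z))).trace.re := by
  have h : ∑ e, (WA.tensor WB).op e * ((WA.tensor WB).op e)ᴴ = P.ρA.mat ⊗ₖ P.ρB.mat := by
    simp only [← hA, ← hB, sum_kronecker_sum, mul_kronecker_mul, conjTranspose_kronecker,
      KrausFamily.tensor_op, Fintype.sum_prod_type]
  rw [P.outputProb_eq_trace_pullback, KrausFamily.trace_pullback, h]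

end QComm

theorem mainTheorem3_general {X : Type*} {Y : Type*} (P : QComm.Protocol X Y) {T : ℕ}
    (hT : P.cost ^ 2 + P.cost ≤ T) :
    ∃ P' : QComm.Protocol X Y, P'.Memoryless ∧ P'.cost = T ∧
      ∀ (x : X) (y : Y) (z : Bool), P'.outputProb x y z = P.outputProb x y z := by
  obtain ⟨WA, hA⟩ := P.ρA.exists_kraus
  obtain ⟨WB, hB⟩ := P.ρB.exists_kraus
  have hsim := P.rest.simulable.aliceSend P.U₁
  have hcost : QComm.simulationCost (P.rest.cost + P.q₁) 0 ≤ T := by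
    refine le_trans (le_of_eq ?_) hT
    simp only [QComm.simulationCost, QComm.Protocol.cost]
    ring
  obtain ⟨P', hmem, hP'T, hP'⟩ :=
    (hsim (fun _ => WA) (fun _ => WB) (by simp) (by simp) hcost).1.exists_protocol
  exact ⟨P', hmem, hP'T, fun x y z => by rw [hP', P.outputProb_eq_trace_kraus hA hB]⟩

theorem mainTheorem3 {X : Type*} {Y : Type*} (Q : ℕ) (P : QComm.Protocol X Y) (hQ : P.cost = Q) :
    ∃ P' : QComm.Protocol X Y,
      P'.Memoryless ∧ P'.cost = Q ^ 2 + 2 * Q ∧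
        ∀ (x : X) (y : Y) (z : Bool), P'.outputProb x y z = P.outputProb x y z :=
  mainTheorem3_general P (by rw [hQ]; omega)
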